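/- **Theorem 3 (Independence of syndromes from logicals).** Let $C_X, C_Z \subseteq \mathbb{F}_2^n$ be binary linear codes of dimensions $k_x, k_z$ with $C_Z^\perp \subseteq C_X$, and let $k = k_x + k_z - n$. A *code state* of $\mathsf{CSS}(C_X, C_Z)$ is a unit vector in $(\mathbb{C}^2)^{\otimes n}$ fixed by all $X(h)$, $h \in C_X^\perp$, and all $Z(g)$, $g \in C_Z^\perp$; in particular $|\overline{+}\rangle = |C_Z|^{-1/2} \sum_{w \in C_Z} |w\rangle$ is one. Let $T \in \mathsf{GL}(n, \mathbb{F}_2)$ be an unencoding map of the $X$ part of the code, that is, its rows $k+1, \dots, k + (n - k_x)$ span $C_X^\perp$, and its first $k$ rows span $C_Z$ together with $C_X^\perp$. Let $U(\theta) = (e^{i\theta Z})^{\otimes n}$. For an initial state $|\psi\rangle$, let $x \in \mathbb{F}_2^n$ have the distribution $p(x) = |\langle x | H^{\otimes n} U(\theta) |\psi\rangle|^2$, let $y = Tx$, and let $\Pr[\,\cdot \mid \overline\rho = |\psi\rangle\langle\psi|\,]$ denote probabilities for this $y$. For every constant $0 < c < 1$ there is a negligible function $\nu$ (for every $m$, $n^m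 \nu(n) \to 0$ as $n \to \infty$) such that the following holds for all $n$ and all such $C_X, C_Z, T$. Suppose that $C_X$ corrects $t$ errors, where $t/n = c$ (some decoder recovers every codeword of $C_X$ from every corruption of it in at most $t$ positions), and that $\theta \in \mathbb{R}$ is below the threshold, $$|\theta| \le \arcsin\!\left(\frac{c}{2e(4e+2)}\right).$$ Then, for every $s \in \{0,1\}^{n - k_x}$ and every code state $|\overline{\ell}\rangle$, $$\Big| \Pr\big[y_{[k+1,\,k+(n-k_x)]} = s \;\big|\; \overline\rho = |\overline{+}\rangle\langle\overline{+}|\big] - \Pr\big[y_{[k+1,\,k+(n-k_x)]} = s \;\big|\; \overline\rho = |\overline{\ell}\rangle\langle\overline{\ell}|\big] \Big| \le \nu(n).$$ -/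

import Mathlib

noncomputable section

namespace HCS

/-! ### Binary linear codes -/

/-- Bit strings of length `n`, as vectors over the field with two elements. -/
abbrev Bits (n : ℕ) : Type := Fin n → ZMod 2

/-- Binary linear codes of length `n`. -/
abbrev LinCode (n : ℕ) : Type := Submodule (ZMod 2) (Bits n)

/-- The dual code: all words orthogonal to every codeword. -/
def dualCode {n : ℕ} (C : LinCode n) : LinCode n where
  carrier := {v | ∀ w ∈ C, v ⬝ᵥ w = 0}
  zero_mem' := fun w _ => zero_dotProduct w
  add_mem' := fun {a b} ha hb w hw => by
    rw [add_dotProduct, ha w hw, hb w hw, add_zero]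
  smul_mem' := fun r v hv w hw => by
    rw [smul_dotProduct, hv w hw, smul_zero]

/-- `C` corrects `t` errors: some decoder recovers every codeword from every
corruption of it in at most `t` positions. -/
def CorrectsErrors {n : ℕ} (C : LinCode n) (t : ℕ) : Prop :=
  ∃ decode : Bits n → Bits n,
    ∀ x ∈ C, ∀ e : Bits n, hammingNorm e ≤ t → decode (x + e) = x

/-! ### Qubits -/

/-- State vectors of `n` qubits, by their amplitudes in the computational basis. -/
abbrev Ket (n : ℕ) : Type := Bits n → ℂ

/-- Operators on `n` qubits, as matrices in the computational basis. -/
abbrev Op (n : ℕ) : Type := Matrix (Bits n) (Bits n) ℂ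

/-- The Pauli `X` matrix. -/
def pauliX : Matrix (ZMod 2) (ZMod 2) ℂ := Matrix.of fun a b => if a = b + 1 then 1 else 0

/-- The Pauli `Z` matrix. -/
def pauliZ : Matrix (ZMod 2) (ZMod 2) ℂ := Matrix.diagonal fun a => (-1 : ℂ) ^ a.val

/-- The Hadamard matrix. -/
def hadamard : Matrix (ZMod 2) (ZMod 2) ℂ :=
  Matrix.of fun a b => (-1 : ℂ) ^ (a.val * b.val) / (Real.sqrt 2 : ℂ)

/-- The tensor product `A 0 ⊗ A 1 ⊗ ⋯` of single-qubit operators. -/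
def tensor {n : ℕ} (A : Fin n → Matrix (ZMod 2) (ZMod 2) ℂ) : Op n :=
  Matrix.of fun x y => ∏ i, A i (x i) (y i)

/-- The Pauli string `X(b)`, with `X` at the positions where `b` is `1`. -/
def xString {n : ℕ} (b : Bits n) : Op n := tensor fun i => pauliX ^ (b i).val

/-- The Pauli string `Z(a)`, with `Z` at the positions where `a` is `1`. -/
def zString {n : ℕ} (a : Bits n) : Op n := tensor fun i => pauliZ ^ (a i).val

/-- The coherent error `U(θ) = (exp (i θ Z))^{⊗ n}`. -/
def coherentError (n : ℕ) (θ : ℝ) : Op n :=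
  tensor fun _ => NormedSpace.exp ((Complex.I * (θ : ℂ)) • pauliZ)

/-- The Hadamard transform `H^{⊗ n}`. -/
def hadamardAll (n : ℕ) : Op n := tensor fun _ => hadamard

/-- The probability `|⟨x| H^{⊗ n} U(θ) |ψ⟩|²` that measuring `U(θ) |ψ⟩` in the `X` basis
yields the string `x`. -/
def outcomeProb {n : ℕ} (θ : ℝ) (ψ : Ket n) (x : Bits n) : ℝ :=
  ‖(hadamardAll n).mulVec ((coherentError n θ).mulVec ψ) x‖ ^ 2

/-! ### CSS codes -/

/-- A CSS code on `n` qubits: two binary linear codes with `C_Z^⊥ ⊆ C_X`. -/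
structure CSSCode (n : ℕ) where
  CX : LinCode n
  CZ : LinCode n
  dual_le : dualCode CZ ≤ CX

namespace CSSCode

variable {n : ℕ} (Q : CSSCode n)

/-- The dimension of `C_X`. -/
def kx : ℕ := Module.finrank (ZMod 2) Q.CX

/-- The dimension of `C_Z`. -/
def kz : ℕ := Module.finrank (ZMod 2) Q.CZ

/-- The number `k_x + k_z - n` of logical qubits. (The inclusion of codes
gives `n ≤ k_x + k_z`, so the subtraction does not truncate.) -/
def k : ℕ := Q.kx + Q.kz - n

/-- Code states: unit vectors fixed by all stabilizers, which are the `X(h)` with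
`h ∈ C_X^⊥` and the `Z(g)` with `g ∈ C_Z^⊥`. -/
structure IsCodeState (ψ : Ket n) : Prop where
  normalized : ∑ x, ‖ψ x‖ ^ 2 = 1
  x_stabilized : ∀ h ∈ dualCode Q.CX, (xString h).mulVec ψ = ψ
  z_stabilized : ∀ g ∈ dualCode Q.CZ, (zString g).mulVec ψ = ψ

open scoped Classical in
/-- The logical all-plus state `|C_Z|^{-1/2} ∑_{w ∈ C_Z} |w⟩`. -/
def plusState : Ket n :=
  fun x => if x ∈ Q.CZ then 1 / (Real.sqrt (Nat.card Q.CZ) : ℂ) else 0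

theorem kx_le : Q.kx ≤ n := by
  have h := Submodule.finrank_le Q.CX
  rwa [Module.finrank_fin_fun] at h

theorem kz_le : Q.kz ≤ n := by
  have h := Submodule.finrank_le Q.CZ
  rwa [Module.finrank_fin_fun] at h

theorem k_add_le : Q.k + (n - Q.kx) ≤ n := by
  have h1 := Q.kx_le
  have h2 := Q.kz_le
  unfold k
  omega

/-- The position of the `i`-th logical bit: positions `1, …, k` (counted from one). -/
def logicalPos (i : Fin Q.k) : Fin n :=
  ⟨i.val, lt_of_lt_of_le i.isLt (le_trans (Nat.le_add_right _ _) Q.k_add_le)⟩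

/-- The position of the `j`-th syndrome bit: positions `k + 1, …, k + (n - k_x)`
(counted from one). -/
def syndromePos (j : Fin (n - Q.kx)) : Fin n :=
  ⟨Q.k + j.val, lt_of_lt_of_le (Nat.add_lt_add_left j.isLt Q.k) Q.k_add_le⟩

/-- `T` is an unencoding map of the `X` part of the code: applied to the outcome `x` of an
`X`-basis measurement, its `n - k_x` syndrome rows, which generate `C_X^⊥`, give the outcome
of the `X` checks, and its first `k` rows, which generate `C_Z` modulo `C_X^⊥`, give the
outcome of a complete set of logical `X` operators. The other rows are unconstrained. -/
structure IsUnencoding (T : Matrix.GeneralLinearGroup (Fin n) (ZMod 2)) : Prop where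
  syndrome_rows :
    Submodule.span (ZMod 2) (Set.range fun j => T.val (Q.syndromePos j)) = dualCode Q.CX
  logical_rows :
    Submodule.span (ZMod 2) (Set.range fun i => T.val (Q.logicalPos i)) ⊔ dualCode Q.CX = Q.CZ

/-- The distribution `q(y) = p(T⁻¹ y)` of the unencoded outcome `y = T x`, when the state
before the coherent error is `ψ`. -/
def unencodedProb (T : Matrix.GeneralLinearGroup (Fin n) (ZMod 2)) (θ : ℝ) (ψ : Ket n)
    (y : Bits n) : ℝ :=
  outcomeProb θ ψ ((T⁻¹).val.mulVec y)

/-- The probability that the syndrome bits of the unencoded outcome `y` equal `s`, when the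
state before the coherent error is `ψ`. -/
def syndromeProb (T : Matrix.GeneralLinearGroup (Fin n) (ZMod 2)) (θ : ℝ) (ψ : Ket n)
    (s : Bits (n - Q.kx)) : ℝ :=
  ∑ y : Bits n with ∀ j, y (Q.syndromePos j) = s j, unencodedProb T θ ψ y

end CSSCode

/-- A negligible function: it decays faster than every inverse polynomial. -/
def Negligible (ν : ℕ → ℝ) : Prop :=
  Asymptotics.SuperpolynomialDecay Filter.atTop (fun n : ℕ => (n : ℝ)) ν

/-- The threshold angle `arcsin (c / (2e(4e + 2)))` for codes correcting a fraction `c` of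
errors. -/
def thresholdAngle (c : ℝ) : ℝ :=
  Real.arcsin (c / (2 * Real.exp 1 * (4 * Real.exp 1 + 2)))

end HCS

end

/-!
Write `φ = H^{⊗n} ψ` for the amplitudes of a code state in the `X` basis. Invariance under `X(h)`,
`h ∈ C_X^⊥`, means that `φ` is supported on `C_X` (`hadamardAll_mulVec_eq_zero`, through the double
dual `dualCode_dualCode`), and `φ` is a unit vector because the Hadamard transform is unitary.
The coherent error is a superposition `∑ a, α_a Z(a)` with `α_a = (cos θ)^{n-|a|} (i sin θ)^{|a|}`
(`coherentError_eq_sum`), and `Z(a)` translates `X`-basis amplitudes by `a`, so the amplitude of the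
outcome `x` is `∑ a, α_a φ(x + a)` (`hadamardAll_mulVec_coherentError_mulVec`).

A syndrome selects the `x` in one coset `S` of `C_X`, and there only errors `a ∈ S` contribute.
Since `C_X` corrects `t` errors, at most one `a ∈ S` has weight at most `t`, so the low-weight part
of the amplitude is `α_a φ(x + a)` for a single `a`, and its squared norm `|α_a|²` over `S` does not
depend on the state (`sum_norm_sq_lowWeight`). The high-weight part has norm at most
`∑_{|a| > t} |sin θ|^{|a|}`, which a Chernoff bound makes at most `e^{-cn/2}` as soon as
`|sin θ| ≤ c / (2e)` (`sum_highWeight_le`); the threshold angle is well below this. Both the plus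
state and `ψ` therefore give the syndrome a probability within `3 e^{-cn/2}` of the same number
(`abs_syndromeProb_sub_le`).
-/

open Finset

namespace HCS

variable {n : ℕ}

/-! ### Dual codes -/

theorem dualCode_eq_orthogonal (C : LinCode n) :
    dualCode C = LinearMap.BilinForm.orthogonal (dotProductBilin (ZMod 2) (ZMod 2)) C := by
  ext v
  refine forall₂_congr fun w _ => ?_
  rw [dotProduct_comm]
  rfl

theorem dualCode_dualCode (C : LinCode n) : dualCode (dualCode C) = C := by
  rw [dualCode_eq_orthogonal (dualCode C), dualCode_eq_orthogonal C]
  refine LinearMap.BilinForm.orthogonal_orthogonal ⟨fun v hv => ?_, fun v hv => ?_⟩ ?_ C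
  · exact dotProduct_eq_zero v hv
  · exact dotProduct_eq_zero v fun w => (dotProduct_comm v w).trans (hv w)
  · exact fun v w h => (dotProduct_comm w v).trans h

theorem dualCode_anti {C D : LinCode n} (h : C ≤ D) : dualCode D ≤ dualCode C :=
  fun _ hv w hw => hv w (h hw)

/-- Distinct correctable errors have distinct syndromes. -/
theorem CorrectsErrors.eq_of_add_mem {C : LinCode n} {t : ℕ} (hC : CorrectsErrors C t)
    {a b : Bits n} (ha : hammingNorm a ≤ t) (hb : hammingNorm b ≤ t) (hab : a + b ∈ C) :
    a = b := by
  have hbb : b + b = 0 := funext fun i => CharTwo.add_self_eq_zero (b i)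
  obtain ⟨decode, hdec⟩ := hC
  have h₁ := hdec (a + b) hab b hb
  have h₂ := hdec 0 C.zero_mem a ha
  rw [add_assoc, hbb, add_zero] at h₁
  rw [zero_add] at h₂
  exact funext fun i => CharTwo.add_eq_zero.1 (congrFun (h₁.symm.trans h₂) i)

/-! ### Tensor products of single-qubit operators -/

theorem tensor_mul_tensor (A B : Fin n → Matrix (ZMod 2) (ZMod 2) ℂ) :
    tensor A * tensor B = tensor fun i => A i * B i := by
  ext x y
  simp only [tensor, Matrix.mul_apply, Matrix.of_apply, Fintype.prod_sum, prod_mul_distrib]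

theorem tensor_one : tensor (fun _ : Fin n => 1) = 1 := by
  ext x y
  simp only [tensor, Matrix.of_apply, Matrix.one_apply, prod_ite_zero, prod_const_one, mem_univ,
    true_imp_iff, funext_iff]

theorem conjTranspose_tensor (A : Fin n → Matrix (ZMod 2) (ZMod 2) ℂ) :
    (tensor A).conjTranspose = tensor fun i => (A i).conjTranspose := by
  ext x y
  simp [tensor, Matrix.conjTranspose_apply]

theorem tensor_sum {κ : Type*} [Fintype κ] (A : Fin n → κ → Matrix (ZMod 2) (ZMod 2) ℂ) :
    tensor (fun i => ∑ b, A i b) = ∑ a : Fin n → κ, tensor fun i => A i (a i) := by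
  classical
  ext x y
  simp only [tensor, Matrix.of_apply, Matrix.sum_apply, Fintype.prod_sum]

theorem tensor_smul (r : Fin n → ℂ) (A : Fin n → Matrix (ZMod 2) (ZMod 2) ℂ) :
    tensor (fun i => r i • A i) = (∏ i, r i) • tensor A := by
  ext x y
  simp [tensor, prod_mul_distrib]

/-! ### Pauli strings in the Hadamard basis -/

theorem forall_zmod_two {p : ZMod 2 → Prop} : (∀ a, p a) ↔ p 0 ∧ p 1 := Fin.forall_fin_two

theorem sum_zmod_two {M : Type*} [AddCommMonoid M] (f : ZMod 2 → M) : ∑ a, f a = f 0 + f 1 :=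
  Fin.sum_univ_two f

theorem zmod_two_val_one : (1 : ZMod 2).val = 1 := rfl

theorem zmod_two_one_add_one : (1 + 1 : ZMod 2) = 0 := rfl

theorem prod_neg_one_pow_val {ι : Type*} (s : Finset ι) (f : ι → ZMod 2) :
    ∏ i ∈ s, (-1 : ℂ) ^ (f i).val = (-1) ^ (∑ i ∈ s, f i).val := by
  classical
  have hadd : ∀ a b : ZMod 2, (-1 : ℂ) ^ a.val * (-1) ^ b.val = (-1) ^ (a + b).val := by
    intro a b
    rw [ZMod.val_add, ← pow_add, ← neg_one_pow_eq_pow_mod_two]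
  induction s using Finset.induction_on with
  | empty => simp
  | insert i s hi ih => rw [prod_insert hi, sum_insert hi, ih, hadd]

theorem hadamard_mul_pauliZ_pow (x b y : ZMod 2) :
    (hadamard * pauliZ ^ b.val) x y = hadamard (x + b) y := by
  revert x b y
  simp [forall_zmod_two, hadamard, pauliZ, zmod_two_one_add_one, zmod_two_val_one,
    neg_div]

theorem hadamard_mul_pauliX_pow (x b y : ZMod 2) :
    (hadamard * pauliX ^ b.val) x y = (-1) ^ (x * b).val * hadamard x y := by
  revert x b y
  simp [forall_zmod_two, sum_zmod_two, hadamard, pauliX, Matrix.mul_apply, zmod_two_one_add_one,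
    zmod_two_val_one, neg_div]

theorem conjTranspose_hadamard_mul_hadamard : hadamard.conjTranspose * hadamard = 1 := by
  have h : (Real.sqrt 2 : ℂ) * Real.sqrt 2 = 2 := by
    rw [← Complex.ofReal_mul, Real.mul_self_sqrt zero_le_two, Complex.ofReal_ofNat]
  have h' : (Real.sqrt 2 : ℂ)⁻¹ * (Real.sqrt 2 : ℂ)⁻¹ = 1 / 2 := by
    rw [← mul_inv, h, one_div]
  ext x y
  revert x y
  simp [forall_zmod_two, sum_zmod_two, hadamard, Matrix.mul_apply, zmod_two_val_one,
    div_eq_mul_inv, h']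
  norm_num

theorem hadamardAll_mulVec_zString_mulVec (a : Bits n) (ψ : Ket n) (x : Bits n) :
    (hadamardAll n).mulVec ((zString a).mulVec ψ) x = (hadamardAll n).mulVec ψ (x + a) := by
  rw [Matrix.mulVec_mulVec, hadamardAll, zString, tensor_mul_tensor]
  simp only [Matrix.mulVec, dotProduct, tensor, Matrix.of_apply, hadamard_mul_pauliZ_pow,
    Pi.add_apply]

theorem hadamardAll_mulVec_xString_mulVec (h : Bits n) (ψ : Ket n) (x : Bits n) :
    (hadamardAll n).mulVec ((xString h).mulVec ψ) x =
      (-1) ^ (x ⬝ᵥ h).val * (hadamardAll n).mulVec ψ x := by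
  rw [Matrix.mulVec_mulVec, hadamardAll, xString, tensor_mul_tensor]
  simp only [Matrix.mulVec, dotProduct, tensor, Matrix.of_apply, hadamard_mul_pauliX_pow,
    prod_mul_distrib, prod_neg_one_pow_val, mul_sum, mul_assoc]

/-- The Hadamard transform is unitary. -/
theorem sum_norm_sq_hadamardAll_mulVec (ψ : Ket n) :
    ∑ x, ‖(hadamardAll n).mulVec ψ x‖ ^ 2 = ∑ x, ‖ψ x‖ ^ 2 := by
  have hdot : ∀ v : Ket n, ((∑ x, ‖v x‖ ^ 2 : ℝ) : ℂ) = star v ⬝ᵥ v := by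
    intro v
    simp [dotProduct, Complex.conj_mul']
  apply Complex.ofReal_injective
  rw [hdot, hdot, Matrix.star_mulVec, ← Matrix.dotProduct_mulVec, Matrix.mulVec_mulVec,
    hadamardAll, conjTranspose_tensor, tensor_mul_tensor]
  simp only [conjTranspose_hadamard_mul_hadamard, tensor_one, Matrix.one_mulVec]

/-- In the `X` basis, a state fixed by the `X` stabilizers is supported on `C`. -/
theorem hadamardAll_mulVec_eq_zero {C : LinCode n} {ψ : Ket n}
    (hψ : ∀ h ∈ dualCode C, (xString h).mulVec ψ = ψ) {x : Bits n} (hx : x ∉ C) :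
    (hadamardAll n).mulVec ψ x = 0 := by
  rw [← dualCode_dualCode C] at hx
  obtain ⟨h, hh, hxh⟩ : ∃ h ∈ dualCode C, x ⬝ᵥ h ≠ 0 := by
    by_contra! hcon
    exact hx hcon
  have key := hadamardAll_mulVec_xString_mulVec h ψ x
  have hval : x ⬝ᵥ h = 1 := by
    have : ∀ a : ZMod 2, a ≠ 0 → a = 1 := by decide
    exact this _ hxh
  rw [hψ h hh, hval, zmod_two_val_one, pow_one, neg_one_mul] at key
  exact self_eq_neg.1 key

/-! ### The coherent error as a superposition of Pauli strings -/

/-- The amplitude `(cos θ)^{n-|a|} (i sin θ)^{|a|}` of `Z(a)` in the coherent error `U(θ)`. -/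
noncomputable def errorAmp (θ : ℝ) (a : Bits n) : ℂ :=
  ∏ i, if a i = 0 then (Real.cos θ : ℂ) else Complex.I * (Real.sin θ : ℂ)

theorem exp_smul_pauliZ (θ : ℝ) :
    NormedSpace.exp ((Complex.I * (θ : ℂ)) • pauliZ) =
      ∑ b : ZMod 2, (if b = 0 then (Real.cos θ : ℂ) else Complex.I * (Real.sin θ : ℂ)) •
        pauliZ ^ b.val := by
  have hexp : ∀ z : ℂ,
      Complex.exp (Complex.I * z) = Complex.cos z + Complex.I * Complex.sin z := by
    intro z
    rw [mul_comm, Complex.exp_mul_I, mul_comm Complex.I]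
  rw [sum_zmod_two, pauliZ, ← Matrix.diagonal_smul, Matrix.exp_diagonal]
  ext x y
  have hneg := hexp (-θ)
  rw [mul_neg, Complex.cos_neg, Complex.sin_neg, mul_neg] at hneg
  revert x y
  simp [forall_zmod_two, zmod_two_val_one, Pi.coe_exp, ← Complex.exp_eq_exp_ℂ, hexp, hneg]

theorem coherentError_eq_sum (θ : ℝ) :
    coherentError n θ = ∑ a : Bits n, errorAmp θ a • zString a := by
  simp only [coherentError, exp_smul_pauliZ, tensor_sum, tensor_smul]
  rfl

theorem hadamardAll_mulVec_coherentError_mulVec (θ : ℝ) (ψ : Ket n) (x : Bits n) :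
    (hadamardAll n).mulVec ((coherentError n θ).mulVec ψ) x =
      ∑ a, errorAmp θ a * (hadamardAll n).mulVec ψ (x + a) := by
  simp only [coherentError_eq_sum, Matrix.sum_mulVec, Matrix.mulVec_sum, Matrix.smul_mulVec,
    Matrix.mulVec_smul, Finset.sum_apply, Pi.smul_apply, hadamardAll_mulVec_zString_mulVec,
    smul_eq_mul]

theorem prod_ite_eq_pow_hammingNorm (q : ℝ) (a : Bits n) :
    ∏ i, (if a i = 0 then 1 else q) = q ^ hammingNorm a := by
  rw [prod_ite, prod_const_one, one_mul, prod_const]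
  rfl

theorem norm_errorAmp_le (θ : ℝ) (a : Bits n) :
    ‖errorAmp θ a‖ ≤ |Real.sin θ| ^ hammingNorm a := by
  rw [errorAmp, norm_prod, ← prod_ite_eq_pow_hammingNorm]
  refine prod_le_prod (fun _ _ => norm_nonneg _) fun i _ => ?_
  split_ifs
  · simpa only [Complex.norm_real, Real.norm_eq_abs] using Real.abs_cos_le_one θ
  · simp only [norm_mul, Complex.norm_I, one_mul, Complex.norm_real, Real.norm_eq_abs, le_refl]

theorem sum_pow_hammingNorm (q : ℝ) : ∑ a : Bits n, q ^ hammingNorm a = (1 + q) ^ n := by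
  simp only [← prod_ite_eq_pow_hammingNorm]
  rw [← Fintype.prod_sum fun (_ : Fin n) (b : ZMod 2) => if b = 0 then (1 : ℝ) else q]
  simp [sum_zmod_two]

/-- Chernoff bound for the total amplitude of the errors of weight above `c n`. -/
theorem sum_highWeight_le {c : ℝ} {t : ℕ} (hn : (t : ℝ) = c * n) {θ : ℝ}
    (hθ : |Real.sin θ| ≤ c / (2 * Real.exp 1)) :
    ∑ a : Bits n with ¬ hammingNorm a ≤ t, ‖errorAmp θ a‖ ≤ Real.exp (-(c / 2)) ^ n := by
  set r := |Real.sin θ|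
  have hr : 0 ≤ r := abs_nonneg _
  have he : 1 ≤ Real.exp 1 := Real.one_le_exp zero_le_one
  -- The weight `e^{|a| - t}` is at least one on the tail; summing it over all errors gives
  -- `e^{-t} (1 + e r)^n ≤ e^{-t} e^{cn/2}`, and `t = c n`.
  have hterm : ∀ a : Bits n, ¬ hammingNorm a ≤ t →
      ‖errorAmp θ a‖ ≤ (Real.exp 1 ^ t)⁻¹ * (Real.exp 1 * r) ^ hammingNorm a := by
    intro a ha
    refine (norm_errorAmp_le θ a).trans ?_
    rw [mul_pow, ← mul_assoc]
    refine le_mul_of_one_le_left (pow_nonneg hr _) ?_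
    rw [inv_mul_eq_div, one_le_div (by positivity)]
    exact pow_le_pow_right₀ he (by omega)
  have her : Real.exp 1 * r ≤ c / 2 := by
    rw [le_div_iff₀ (by positivity)] at hθ
    linarith
  calc ∑ a : Bits n with ¬ hammingNorm a ≤ t, ‖errorAmp θ a‖
      ≤ ∑ a : Bits n with ¬ hammingNorm a ≤ t,
          (Real.exp 1 ^ t)⁻¹ * (Real.exp 1 * r) ^ hammingNorm a :=
        sum_le_sum fun a ha => hterm a (mem_filter.1 ha).2
    _ ≤ ∑ a : Bits n, (Real.exp 1 ^ t)⁻¹ * (Real.exp 1 * r) ^ hammingNorm a :=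
        sum_le_sum_of_subset_of_nonneg (filter_subset _ _) fun _ _ _ => by positivity
    _ = (Real.exp 1 ^ t)⁻¹ * (1 + Real.exp 1 * r) ^ n := by
        rw [← mul_sum, sum_pow_hammingNorm]
    _ ≤ (Real.exp 1 ^ t)⁻¹ * Real.exp (c / 2) ^ n := by
        gcongr
        linarith [Real.add_one_le_exp (c / 2)]
    _ = Real.exp (-(c / 2)) ^ n := by
        rw [← Real.exp_nat_mul, ← Real.exp_nat_mul, ← Real.exp_nat_mul, ← Real.exp_neg,
          ← Real.exp_add, hn]
        ring_nf

/-! ### Splitting the amplitudes of a syndrome by error weight -/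

/-- On a coset of `C` only one error of weight at most `t` contributes, so the norm of the
low-weight part of the amplitudes does not depend on the state `φ`. -/
theorem sum_norm_sq_lowWeight {C : LinCode n} {t : ℕ} (hC : CorrectsErrors C t)
    {φ : Ket n} (hφ : ∑ x, ‖φ x‖ ^ 2 = 1) (hsupp : ∀ x ∉ C, φ x = 0)
    {S : Finset (Bits n)} (hS : ∀ x ∈ S, ∀ y, y ∈ S ↔ x + y ∈ C) (α : Bits n → ℂ) :
    ∑ x ∈ S, ‖∑ a with hammingNorm a ≤ t, α a * φ (x + a)‖ ^ 2 =
      ∑ a ∈ S with hammingNorm a ≤ t, ‖α a‖ ^ 2 := by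
  have hlow : ∀ x ∈ S, ∑ a with hammingNorm a ≤ t, α a * φ (x + a) =
      ∑ a ∈ S with hammingNorm a ≤ t, α a * φ (x + a) := by
    intro x hx
    symm
    refine sum_subset (filter_subset_filter _ (subset_univ _)) fun a ha ha' => ?_
    have haS : a ∉ S := fun h => ha' (mem_filter.2 ⟨h, (mem_filter.1 ha).2⟩)
    rw [hsupp _ fun h => haS ((hS x hx a).2 h), mul_zero]
  rw [sum_congr rfl fun x hx => by rw [hlow x hx]]
  rcases (S.filter fun a => hammingNorm a ≤ t).eq_empty_or_nonempty with hF | ⟨b, hb⟩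
  · simp [hF]
  · obtain ⟨hbS, hbt⟩ := mem_filter.1 hb
    have hF : (S.filter fun a => hammingNorm a ≤ t) = {b} := by
      refine eq_singleton_iff_unique_mem.2 ⟨hb, fun a ha => ?_⟩
      obtain ⟨haS, hat⟩ := mem_filter.1 ha
      exact hC.eq_of_add_mem hat hbt ((hS a haS b).1 hbS)
    simp only [hF, sum_singleton, norm_mul, mul_pow, ← mul_sum]
    have hsum : ∑ x ∈ S, ‖φ (x + b)‖ ^ 2 = 1 := by
      rw [← hφ, ← Equiv.sum_comp (Equiv.addRight b) fun x => ‖φ x‖ ^ 2]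
      refine sum_subset (subset_univ _) fun x _ hx => ?_
      have hxb : x + b ∉ C := fun h => hx ((hS b hbS x).2 (add_comm x b ▸ h))
      simp [hsupp _ hxb]
    rw [hsum, mul_one]

/-- The `ℓ²` norm over `S` of a function on bit strings. -/
noncomputable def normOn (S : Finset (Bits n)) (f : Ket n) : ℝ :=
  ‖WithLp.toLp 2 fun x : S => f x‖

theorem normOn_sq (S : Finset (Bits n)) (f : Ket n) :
    normOn S f ^ 2 = ∑ x ∈ S, ‖f x‖ ^ 2 := by
  rw [normOn, EuclideanSpace.norm_sq_eq]
  exact sum_coe_sort S fun x => ‖f x‖ ^ 2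

theorem normOn_nonneg (S : Finset (Bits n)) (f : Ket n) : 0 ≤ normOn S f := norm_nonneg _

theorem normOn_add_le (S : Finset (Bits n)) (f g : Ket n) :
    normOn S (f + g) ≤ normOn S f + normOn S g :=
  norm_add_le (WithLp.toLp 2 fun x : S => f x) (WithLp.toLp 2 fun x : S => g x)

theorem abs_normOn_add_sub_le (S : Finset (Bits n)) (f g : Ket n) :
    |normOn S (f + g) - normOn S f| ≤ normOn S g := by
  have h := abs_norm_sub_norm_le (WithLp.toLp 2 fun x : S => (f + g) x)
    (WithLp.toLp 2 fun x : S => f x)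
  rw [← WithLp.toLp_sub] at h
  refine h.trans_eq (congrArg (fun v : S → ℂ => ‖WithLp.toLp 2 v‖) ?_)
  ext x
  simp

/-- A superposition of translates of a unit vector has norm at most the total amplitude. -/
theorem normOn_sum_translate_le {φ : Ket n} (hφ : ∑ x, ‖φ x‖ ^ 2 = 1) (S A : Finset (Bits n))
    (α : Bits n → ℂ) :
    normOn S (fun x => ∑ a ∈ A, α a * φ (x + a)) ≤ ∑ a ∈ A, ‖α a‖ := by
  have hsum : (WithLp.toLp 2 fun x : S => ∑ a ∈ A, α a * φ (x + a)) =
      ∑ a ∈ A, α a • WithLp.toLp 2 fun x : S => φ (x + a) := by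
    ext x
    simp
  rw [normOn, hsum]
  refine (norm_sum_le _ _).trans (sum_le_sum fun a _ => ?_)
  rw [norm_smul]
  refine mul_le_of_le_one_right (norm_nonneg _) ?_
  change normOn S (fun x => φ (x + a)) ≤ 1
  rw [← sq_le_one_iff₀ (normOn_nonneg _ _), normOn_sq, ← hφ,
    ← Equiv.sum_comp (Equiv.addRight a) fun x => ‖φ x‖ ^ 2]
  exact sum_le_sum_of_subset_of_nonneg (subset_univ _) fun _ _ _ => by positivity

/-- On a coset of `C`, the squared norm of the amplitudes is, up to the contribution `ε` of the
high-weight errors, a quantity that does not depend on the state `φ`. -/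
theorem abs_sum_norm_sq_sub_le {C : LinCode n} {t : ℕ} (hC : CorrectsErrors C t)
    {φ : Ket n} (hφ : ∑ x, ‖φ x‖ ^ 2 = 1) (hsupp : ∀ x ∉ C, φ x = 0)
    {S : Finset (Bits n)} (hS : ∀ x ∈ S, ∀ y, y ∈ S ↔ x + y ∈ C) {α : Bits n → ℂ}
    (hα : ∀ a, ‖α a‖ ≤ 1) {ε : ℝ} (hε1 : ε ≤ 1)
    (hε : ∑ a with ¬ hammingNorm a ≤ t, ‖α a‖ ≤ ε) :
    |∑ x ∈ S, ‖∑ a, α a * φ (x + a)‖ ^ 2 - ∑ a ∈ S with hammingNorm a ≤ t, ‖α a‖ ^ 2| ≤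
      3 * ε := by
  set f : Ket n := fun x => ∑ a with hammingNorm a ≤ t, α a * φ (x + a) with hf
  set g : Ket n := fun x => ∑ a with ¬ hammingNorm a ≤ t, α a * φ (x + a) with hg
  have hfg : ∀ x, ∑ a, α a * φ (x + a) = (f + g) x := fun x =>
    (sum_filter_add_sum_filter_not univ (fun a => hammingNorm a ≤ t) _).symm
  have hlow := sum_norm_sq_lowWeight hC hφ hsupp hS α
  have hgε : normOn S g ≤ ε := (normOn_sum_translate_le hφ S _ α).trans hε
  have hf1 : normOn S f ≤ 1 := by
    rw [← sq_le_one_iff₀ (normOn_nonneg _ _), normOn_sq, hlow]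
    have hcard : (S.filter fun a => hammingNorm a ≤ t).card ≤ 1 := by
      refine card_le_one.2 fun a ha b hb => ?_
      rw [mem_filter] at ha hb
      exact hC.eq_of_add_mem ha.2 hb.2 ((hS a ha.1 b).1 hb.1)
    calc ∑ a ∈ S with hammingNorm a ≤ t, ‖α a‖ ^ 2
        ≤ ∑ a ∈ S with hammingNorm a ≤ t, (1 : ℝ) :=
          sum_le_sum fun a _ => pow_le_one₀ (norm_nonneg _) (hα a)
      _ ≤ 1 := by simpa using hcard
  rw [← hlow]
  simp only [hfg]
  rw [← normOn_sq, ← normOn_sq, sq_sub_sq, abs_mul, mul_comm]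
  have h₁ := (abs_normOn_add_sub_le S f g).trans hgε
  have h₂ : |normOn S (f + g) + normOn S f| ≤ 3 := by
    rw [abs_of_nonneg (add_nonneg (normOn_nonneg _ _) (normOn_nonneg _ _))]
    linarith [normOn_add_le S f g]
  calc |normOn S (f + g) - normOn S f| * |normOn S (f + g) + normOn S f|
      ≤ ε * 3 := mul_le_mul h₁ h₂ (abs_nonneg _) ((abs_nonneg _).trans h₁)
    _ = 3 * ε := mul_comm _ _

/-! ### Syndrome probabilities -/

theorem xString_mulVec (h : Bits n) (ψ : Ket n) (x : Bits n) :
    (xString h).mulVec ψ x = ψ (x + h) := by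
  have hpow : ∀ a b d : ZMod 2, (pauliX ^ b.val) a d = if d = a + b then 1 else 0 := by
    simp [forall_zmod_two, pauliX, zmod_two_one_add_one, zmod_two_val_one]
  simp only [Matrix.mulVec, dotProduct, xString, tensor, Matrix.of_apply, hpow, prod_ite_zero,
    prod_const_one, mem_univ, true_imp_iff]
  rw [sum_eq_single (x + h)]
  · simp
  · intro y _ hy
    exact mul_eq_zero_of_left (if_neg fun hall => hy (funext hall)) _
  · exact fun hx => absurd (mem_univ _) hx

namespace CSSCode

variable (Q : CSSCode n)

theorem dualCode_CX_le : dualCode Q.CX ≤ Q.CZ := by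
  simpa only [dualCode_dualCode] using dualCode_anti Q.dual_le

theorem sum_norm_sq_plusState : ∑ x, ‖Q.plusState x‖ ^ 2 = 1 := by
  classical
  have hpos : (0 : ℝ) < Nat.card Q.CZ := Nat.cast_pos.2 Nat.card_pos
  have hterm : ∀ x, ‖Q.plusState x‖ ^ 2 = if x ∈ Q.CZ then 1 / (Nat.card Q.CZ : ℝ) else 0 := by
    intro x
    rw [plusState]
    split_ifs
    · rw [norm_div, norm_one, Complex.norm_real, div_pow, one_pow, Real.norm_eq_abs, sq_abs,
        Real.sq_sqrt hpos.le]
    · simp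
  simp only [hterm]
  rw [← sum_filter, sum_const, nsmul_eq_mul, ← Fintype.card_subtype, ← Nat.card_eq_fintype_card]
  exact mul_one_div_cancel hpos.ne'

theorem xString_mulVec_plusState {h : Bits n} (hh : h ∈ dualCode Q.CX) :
    (xString h).mulVec Q.plusState = Q.plusState := by
  ext x
  have hmem : x + h ∈ Q.CZ ↔ x ∈ Q.CZ := Q.CZ.add_mem_iff_left (Q.dualCode_CX_le hh)
  simp only [xString_mulVec, plusState]
  split_ifs <;> first | rfl | tauto

/-- The outcomes `x` with syndrome `s`: those for which the syndrome bits of `T x` equal `s`. -/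
noncomputable def syndromeFibre (T : Matrix.GeneralLinearGroup (Fin n) (ZMod 2))
    (s : Bits (n - Q.kx)) : Finset (Bits n) :=
  univ.filter fun x => ∀ j, T.val.mulVec x (Q.syndromePos j) = s j

theorem mem_syndromeFibre {T : Matrix.GeneralLinearGroup (Fin n) (ZMod 2)}
    {s : Bits (n - Q.kx)} {x : Bits n} :
    x ∈ Q.syndromeFibre T s ↔ ∀ j, T.val (Q.syndromePos j) ⬝ᵥ x = s j := by
  rw [syndromeFibre, mem_filter]
  exact and_iff_right (mem_univ x)

theorem syndromeProb_eq (T : Matrix.GeneralLinearGroup (Fin n) (ZMod 2)) (θ : ℝ) (ψ : Ket n)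
    (s : Bits (n - Q.kx)) :
    Q.syndromeProb T θ ψ s = ∑ x ∈ Q.syndromeFibre T s, outcomeProb θ ψ x := by
  have hinv : ∀ x, (T⁻¹).val.mulVec (T.val.mulVec x) = x := fun x => by
    rw [Matrix.mulVec_mulVec, Units.inv_mul, Matrix.one_mulVec]
  have hinv' : ∀ y, T.val.mulVec ((T⁻¹).val.mulVec y) = y := fun y => by
    rw [Matrix.mulVec_mulVec, Units.mul_inv, Matrix.one_mulVec]
  refine sum_nbij' (fun y => (T⁻¹).val.mulVec y) (fun x => T.val.mulVec x) ?_ ?_ ?_ ?_ ?_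
  · intro y hy
    simpa only [syndromeFibre, mem_filter, mem_univ, true_and, hinv'] using hy
  · intro x hx
    simpa only [syndromeFibre, mem_filter, mem_univ, true_and] using hx
  · exact fun y _ => hinv' y
  · exact fun x _ => hinv x
  · exact fun y _ => rfl

/-- A syndrome fibre is empty or a coset of `C_X`, since the syndrome rows span its dual. -/
theorem mem_syndromeFibre_iff {T : Matrix.GeneralLinearGroup (Fin n) (ZMod 2)}
    (hT : Q.IsUnencoding T) {s : Bits (n - Q.kx)} {x : Bits n} (hx : x ∈ Q.syndromeFibre T s)
    (y : Bits n) : y ∈ Q.syndromeFibre T s ↔ x + y ∈ Q.CX := by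
  rw [mem_syndromeFibre] at hx ⊢
  rw [← dualCode_dualCode Q.CX, ← hT.syndrome_rows]
  constructor
  · intro hy w hw
    induction hw using Submodule.span_induction with
    | mem w hw =>
      obtain ⟨j, rfl⟩ := hw
      change (x + y) ⬝ᵥ T.val (Q.syndromePos j) = 0
      rw [dotProduct_comm, dotProduct_add, hx, hy, CharTwo.add_self_eq_zero]
    | zero => exact dotProduct_zero _
    | add u v _ _ hu hv => rw [dotProduct_add, hu, hv, add_zero]
    | smul r u _ hu => rw [dotProduct_smul, hu, smul_zero]
  · intro h j
    have hj := h _ (Submodule.subset_span ⟨j, rfl⟩)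
    rw [dotProduct_comm, dotProduct_add, CharTwo.add_eq_zero] at hj
    exact hj.symm.trans (hx j)

/-- The probability of a syndrome is, up to the total amplitude `ε` of the uncorrectable errors,
the probability of the correctable error with this syndrome. -/
theorem abs_syndromeProb_sub_le {t : ℕ} (hC : CorrectsErrors Q.CX t)
    {T : Matrix.GeneralLinearGroup (Fin n) (ZMod 2)} (hT : Q.IsUnencoding T) (θ : ℝ)
    (s : Bits (n - Q.kx)) {ε : ℝ} (hε1 : ε ≤ 1)
    (hε : ∑ a : Bits n with ¬ hammingNorm a ≤ t, ‖errorAmp θ a‖ ≤ ε)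
    {ψ : Ket n} (hψ : ∑ x, ‖ψ x‖ ^ 2 = 1)
    (hstab : ∀ h ∈ dualCode Q.CX, (xString h).mulVec ψ = ψ) :
    |Q.syndromeProb T θ ψ s -
      ∑ a ∈ Q.syndromeFibre T s with hammingNorm a ≤ t, ‖errorAmp θ a‖ ^ 2| ≤ 3 * ε := by
  simp only [syndromeProb_eq, outcomeProb, hadamardAll_mulVec_coherentError_mulVec]
  refine abs_sum_norm_sq_sub_le hC ((sum_norm_sq_hadamardAll_mulVec ψ).trans hψ)
    (fun x hx => hadamardAll_mulVec_eq_zero hstab hx)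
    (fun x hx => Q.mem_syndromeFibre_iff hT hx) (fun a => ?_) hε1 hε
  exact (norm_errorAmp_le θ a).trans (pow_le_one₀ (abs_nonneg _) (Real.abs_sin_le_one θ))

end CSSCode

/-! ### The threshold angle -/

theorem abs_sin_le_of_abs_le_thresholdAngle {c θ : ℝ} (hc0 : 0 < c) (hc1 : c < 1)
    (hθ : |θ| ≤ thresholdAngle c) : |Real.sin θ| ≤ c / (2 * Real.exp 1) := by
  have he : 1 ≤ Real.exp 1 := Real.one_le_exp zero_le_one
  have hle : c / (2 * Real.exp 1 * (4 * Real.exp 1 + 2)) ≤ c / (2 * Real.exp 1) :=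
    div_le_div_of_nonneg_left hc0.le (by positivity)
      (le_mul_of_one_le_right (by positivity) (by linarith))
  have hle1 : c / (2 * Real.exp 1) ≤ 1 := by
    rw [div_le_one (by positivity)]
    linarith
  have hpi : |θ| ≤ Real.pi / 2 := hθ.trans (Real.arcsin_le_pi_div_two _)
  calc |Real.sin θ| = Real.sin |θ| := by
        rcases abs_cases θ with ⟨h, h0⟩ | ⟨h, h0⟩
        · rw [h, abs_of_nonneg]
          exact Real.sin_nonneg_of_nonneg_of_le_pi h0 (by linarith [Real.pi_pos])
        · rw [h, Real.sin_neg, abs_of_nonpos]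
          exact Real.sin_nonpos_of_nonpos_of_neg_pi_le h0.le (by linarith [Real.pi_pos])
    _ ≤ Real.sin (thresholdAngle c) :=
        Real.sin_le_sin_of_le_of_le_pi_div_two
          (by linarith [Real.pi_pos, abs_nonneg θ]) (Real.arcsin_le_pi_div_two _) hθ
    _ = c / (2 * Real.exp 1 * (4 * Real.exp 1 + 2)) :=
        Real.sin_arcsin (le_trans (by norm_num) (div_nonneg hc0.le (by positivity)))
          (hle.trans hle1)
    _ ≤ c / (2 * Real.exp 1) := hle

end HCS

theorem theorem3 (c : ℝ) (hc0 : 0 < c) (hc1 : c < 1) :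
    ∃ ν : ℕ → ℝ, HCS.Negligible ν ∧
      ∀ (n t : ℕ) (Q : HCS.CSSCode n) (T : Matrix.GeneralLinearGroup (Fin n) (ZMod 2)) (θ : ℝ),
        (t : ℝ) / (n : ℝ) = c →
        HCS.CorrectsErrors Q.CX t →
        Q.IsUnencoding T →
        |θ| ≤ HCS.thresholdAngle c →
        ∀ (s : HCS.Bits (n - Q.kx)) (ψ : HCS.Ket n), Q.IsCodeState ψ →
          |Q.syndromeProb T θ Q.plusState s - Q.syndromeProb T θ ψ s| ≤ ν n := by
  have hq1 : Real.exp (-(c / 2)) < 1 := Real.exp_lt_one_iff.2 (by linarith)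
  refine ⟨fun n => 6 * Real.exp (-(c / 2)) ^ n, fun k => ?_, ?_⟩
  · have h := (tendsto_pow_const_mul_const_pow_of_lt_one k (Real.exp_pos _).le hq1).const_mul 6
    simpa only [mul_zero, mul_left_comm] using h
  · intro n t Q T θ ht hC hT hθ s ψ hψ
    have hn : (n : ℝ) ≠ 0 := by
      -- Otherwise `t / n` is `0` by convention, and not `c`.
      intro h
      rw [h, div_zero] at ht
      exact hc0.ne ht
    have htail := HCS.sum_highWeight_le ((div_eq_iff hn).1 ht)
      (HCS.abs_sin_le_of_abs_le_thresholdAngle hc0 hc1 hθ)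
    have hε1 : Real.exp (-(c / 2)) ^ n ≤ 1 := pow_le_one₀ (Real.exp_pos _).le hq1.le
    have h₁ := Q.abs_syndromeProb_sub_le hC hT θ s hε1 htail Q.sum_norm_sq_plusState
      fun h hh => Q.xString_mulVec_plusState hh
    have h₂ := Q.abs_syndromeProb_sub_le hC hT θ s hε1 htail hψ.normalized hψ.x_stabilized
    rw [abs_le] at h₁ h₂ ⊢
    constructor <;> linarith [h₁.1, h₁.2, h₂.1, h₂.2]
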